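/- Let $n\ge 0$ be an integer and let $\eta,\alpha,\beta,\gamma,\delta\in\mathbb C$ with $\alpha\neq 0$. Consider the $4n$-dimensional space of $2\times2$ polynomial matrices $$T(\lambda)=\begin{pmatrix}A(\lambda)&B(\lambda)\\ C(\lambda)&D(\lambda)\end{pmatrix} =\begin{pmatrix}\alpha\lambda^n+A_1\lambda^{n-1}+\dots+A_n&\beta\lambda^n+B_1\lambda^{n-1}+\dots+B_n\\ \gamma\lambda^n+C_1\lambda^{n-1}+\dots+C_n&\delta\lambda^n+D_1\lambda^{n-1}+\dots+D_n\end{pmatrix}$$ with fixed leading coefficients $\alpha,\beta,\gamma,\delta$, and its algebra of polynomial functions $\mathbb C[A_i,B_i,C_i,D_i : 1\le i\le n]$. On this algebra each of the following two systems of relations, required for all complex $\lambda\ne\mu$, is satisfied by exactly one $\mathbb C$-bilinear, skew-symmetric bracket obeying the Leibniz rule: (0) the Sklyanin bracket $\{\cdot,\cdot\}_0$, $$\{T(\lambda)\otimes I,\ I\otimes T(\mu)\}_0=\Bigl[\tfrac{\eta}{\lambda-\mu}\Pi,\ (T(\lambda)\otimes I)(I\otimes T(\mu))\Bigr],$$ where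 $\Pi$ is the permutation matrix of $\mathbb C^2\otimes\mathbb C^2$ and the entry of the left-hand side in row $(i,j)$ and column $(k,l)$ is $\{T_{ik}(\lambda),T_{jl}(\mu)\}_0$; (1) the bracket $\{\cdot,\cdot\}_1$ with $$\{A(\lambda),A(\mu)\}_1=\{B(\lambda),B(\mu)\}_1=\{C(\lambda),C(\mu)\}_1=0,$$ $$\{B(\lambda),A(\mu)\}_1=\tfrac{\eta}{\lambda-\mu}\bigl(\lambda B(\lambda)A(\mu)-\mu B(\mu)A(\lambda)\bigr)-\tfrac{\eta\beta}{\alpha}A(\lambda)A(\mu),$$ $$\{C(\lambda),A(\mu)\}_1=\tfrac{-\eta}{\lambda-\mu}\bigl(\lambda C(\lambda)A(\mu)-\mu C(\mu)A(\lambda)\bigr)+\tfrac{\eta\gamma}{\alpha}A(\lambda)A(\mu),$$ $$\{B(\lambda),C(\mu)\}_1=\tfrac{\eta}{\lambda-\mu}\bigl(\lambda D(\lambda)A(\mu)-\mu D(\mu)A(\lambda)\bigr)-\tfrac{\eta\delta}{\alpha}A(\lambda)A(\mu),$$ $$\{B(\lambda),D(\mu)\}_1=\tfrac{-\eta\lambda}{\lambda-\mu}\bigl(B(\lambda)D(\mu)-B(\mu)D(\lambda)\bigr)+\eta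 A(\lambda)\bigl(\tfrac{\beta}{\alpha}D(\mu)-\tfrac{\delta}{\alpha}B(\mu)\bigr),$$ $$\{C(\lambda),D(\mu)\}_1=\tfrac{\eta\lambda}{\lambda-\mu}\bigl(C(\lambda)D(\mu)-C(\mu)D(\lambda)\bigr)-\eta A(\lambda)\bigl(\tfrac{\gamma}{\alpha}D(\mu)-\tfrac{\delta}{\alpha}C(\mu)\bigr),$$ $$\{A(\lambda),D(\mu)\}_1=\tfrac{\eta\lambda}{\lambda-\mu}\bigl(C(\lambda)B(\mu)-C(\mu)B(\lambda)\bigr)-\eta A(\lambda)\bigl(\tfrac{\gamma}{\alpha}B(\mu)-\tfrac{\beta}{\alpha}C(\mu)\bigr),$$ $$\{D(\lambda),D(\mu)\}_1=\tfrac{\eta\gamma}{\alpha}\bigl(D(\lambda)B(\mu)-D(\mu)B(\lambda)\bigr)-\tfrac{\eta\beta}{\alpha}\bigl(D(\lambda)C(\mu)-D(\mu)C(\lambda)\bigr)+\tfrac{\eta\delta}{\alpha}\bigl(B(\lambda)C(\mu)-B(\mu)C(\lambda)\bigr).$$ The two brackets are compatible: for all $a,b\in\mathbb C$ the bracket $a\{\cdot,\cdot\}_0+b\{\cdot,\cdot\}_1$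 is a Poisson bracket, that is, it is bilinear and skew-symmetric and satisfies the Leibniz rule and the Jacobi identity. -/

import Mathlib

open scoped Kronecker

/-- A bilinear, skew-symmetric operation on a commutative `ℂ`-algebra that is a derivation in its
first argument (hence, by skew-symmetry, in each argument). -/
structure IsSkewBiderivation {R : Type*} [CommRing R] [Algebra ℂ R]
    (br : R →ₗ[ℂ] R →ₗ[ℂ] R) : Prop where
  self_eq_zero : ∀ f, br f f = 0
  leibniz : ∀ f g h, br (f * g) h = f * br g h + g * br f h

/-- A Poisson bracket on a commutative `ℂ`-algebra. -/
structure IsPoissonBracket {R : Type*} [CommRing R] [Algebra ℂ R]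
    (br : R →ₗ[ℂ] R →ₗ[ℂ] R) : Prop extends IsSkewBiderivation br where
  jacobi : ∀ f g h, br f (br g h) + br g (br h f) + br h (br f g) = 0

/-- Two brackets are compatible if every linear combination of them is a Poisson bracket. -/
def AreCompatible {R : Type*} [CommRing R] [Algebra ℂ R]
    (br₀ br₁ : R →ₗ[ℂ] R →ₗ[ℂ] R) : Prop :=
  ∀ a b : ℂ, IsPoissonBracket (a • br₀ + b • br₁)

/-- The algebra of polynomial functions on the `4n`-dimensional space of matrices `T(u)`: the
variable `(i, j, k)` is the coefficient of `u ^ (n - 1 - k)` in the entry `(i, j)` of `T(u)`. So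
`(0, 0, k)`, `(0, 1, k)`, `(1, 0, k)`, `(1, 1, k)` are
`A_{k+1}`, `B_{k+1}`, `C_{k+1}`, `D_{k+1}`. -/
abbrev CoeffAlgebra (n : ℕ) : Type := MvPolynomial (Fin 2 × Fin 2 × Fin n) ℂ

/-- The type of bilinear operations on the algebra of polynomial functions. -/
abbrev CoeffBracket (n : ℕ) : Type :=
  CoeffAlgebra n →ₗ[ℂ] CoeffAlgebra n →ₗ[ℂ] CoeffAlgebra n

/-- The polynomial matrix `T(u)` of degree `n` with fixed matrix `L` of coefficients of `u ^ n`,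
at the value `u` of the spectral parameter. -/
noncomputable def polyMatrix (n : ℕ) (L : Matrix (Fin 2) (Fin 2) ℂ) (u : ℂ) :
    Matrix (Fin 2) (Fin 2) (CoeffAlgebra n) :=
  Matrix.of fun i j =>
    MvPolynomial.C (L i j * u ^ n) +
      ∑ k : Fin n, MvPolynomial.C (u ^ (n - 1 - (k : ℕ))) * MvPolynomial.X (i, j, k)

/-- The permutation matrix `Π` of `ℂ² ⊗ ℂ²`. -/
def permMatrix : Matrix (Fin 2 × Fin 2) (Fin 2 × Fin 2) ℂ :=
  Matrix.of fun p q => if p.1 = q.2 ∧ p.2 = q.1 then 1 else 0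

/-- The rational `r`-matrix `r(u) = (η / u) Π`. -/
noncomputable def rationalRMatrix (η u : ℂ) : Matrix (Fin 2 × Fin 2) (Fin 2 × Fin 2) ℂ :=
  (η / u) • permMatrix

/-- The relations of the Sklyanin bracket,
`{T(u) ⊗ 1, 1 ⊗ T(v)} = [r(u - v), (T(u) ⊗ 1) (1 ⊗ T(v))]`. -/
def SatisfiesSklyanin (n : ℕ) (η : ℂ) (L : Matrix (Fin 2) (Fin 2) ℂ)
    (br : CoeffBracket n) : Prop :=
  ∀ u v : ℂ, u ≠ v →
    (Matrix.of fun p q : Fin 2 × Fin 2 =>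
        br (polyMatrix n L u p.1 q.1) (polyMatrix n L v p.2 q.2)) =
      ⁅(rationalRMatrix η (u - v)).map (MvPolynomial.C (σ := Fin 2 × Fin 2 × Fin n)),
        (polyMatrix n L u ⊗ₖ (1 : Matrix (Fin 2) (Fin 2) (CoeffAlgebra n))) *
          ((1 : Matrix (Fin 2) (Fin 2) (CoeffAlgebra n)) ⊗ₖ polyMatrix n L v)⁆

/-- The entry-wise relations of the second bracket, for functions `A B C D` of the spectral
parameter with values in a commutative `ℂ`-algebra and numbers `α β γ δ`. -/
structure SecondRelations {R : Type*} [CommRing R] [Algebra ℂ R] (η α β γ δ : ℂ)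
    (A B C D : ℂ → R) (br : R →ₗ[ℂ] R →ₗ[ℂ] R) : Prop where
  AA : ∀ u v, u ≠ v → br (A u) (A v) = 0
  BB : ∀ u v, u ≠ v → br (B u) (B v) = 0
  CC : ∀ u v, u ≠ v → br (C u) (C v) = 0
  BA : ∀ u v, u ≠ v → br (B u) (A v) =
    (η / (u - v)) • (u • (B u * A v) - v • (B v * A u)) - (η * β / α) • (A u * A v)
  CA : ∀ u v, u ≠ v → br (C u) (A v) =
    (-η / (u - v)) • (u • (C u * A v) - v • (C v * A u)) + (η * γ / α) • (A u * A v)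
  BC : ∀ u v, u ≠ v → br (B u) (C v) =
    (η / (u - v)) • (u • (D u * A v) - v • (D v * A u)) - (η * δ / α) • (A u * A v)
  BD : ∀ u v, u ≠ v → br (B u) (D v) =
    (-(η * u) / (u - v)) • (B u * D v - B v * D u)
      + η • (A u * ((β / α) • D v - (δ / α) • B v))
  CD : ∀ u v, u ≠ v → br (C u) (D v) =
    ((η * u) / (u - v)) • (C u * D v - C v * D u)
      - η • (A u * ((γ / α) • D v - (δ / α) • C v))
  AD : ∀ u v, u ≠ v → br (A u) (D v) =
    ((η * u) / (u - v)) • (C u * B v - C v * B u)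
      - η • (A u * ((γ / α) • B v - (β / α) • C v))
  DD : ∀ u v, u ≠ v → br (D u) (D v) =
    (η * γ / α) • (D u * B v - D v * B u) - (η * β / α) • (D u * C v - D v * C u)
      + (η * δ / α) • (B u * C v - B v * C u)

/-- The relations of the second bracket for the entries of the matrix
`T(u) = (A(u), B(u); C(u), D(u))` with leading coefficients `α, β, γ, δ`. -/
def SatisfiesSecond (n : ℕ) (η α β γ δ : ℂ) (br : CoeffBracket n) : Prop :=
  SecondRelations η α β γ δ
    (fun u => polyMatrix n !![α, β; γ, δ] u 0 0) (fun u => polyMatrix n !![α, β; γ, δ] u 0 1)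
    (fun u => polyMatrix n !![α, β; γ, δ] u 1 0) (fun u => polyMatrix n !![α, β; γ, δ] u 1 1) br

/-! The relations of both brackets fit one family, `pencil`, linear in `(a, b)`: `(1, 0)` is the
Sklyanin bracket and `(0, 1)` the second one. Roughly, the weights become `a + b * u` and the
correction terms in the leading coefficients are multiplied by `b`. Compatibility is therefore the
Jacobi identity for every bracket satisfying these relations.

The Jacobiator of a skew biderivation is again a derivation in each argument, so it suffices to kill
it on the variables. Since leading coefficients are constants, a linear map vanishing on constants
is determined on the coefficients of an entry by its values on that entry at infinitely many `u`
(`map_X_eq_zero_of_polyMatrix`). Hence Jacobi need only be checked on entries at three distinct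
parameters, where it is an identity of rational functions (`SatisfiesPencil.jacobiator_sorted`). The
same interpolation gives uniqueness.

For existence, the right-hand sides must be polynomials of degree less than `n` in each parameter.
Subtracting from each entry the multiple of `A` with the same leading term absorbs the correction
terms and leaves Bezoutians and products of low degree (`pencil_mem_biPolyFun_of_le`). The resulting
coefficients prescribe the bracket on the variables. -/

/-! ### Skew biderivations. -/

namespace IsSkewBiderivation

variable {R : Type*} [CommRing R] [Algebra ℂ R] {br : R →ₗ[ℂ] R →ₗ[ℂ] R}

theorem skew (h : IsSkewBiderivation br) (f g : R) : br f g = -br g f := by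
  have := h.self_eq_zero (f + g)
  simp only [map_add, LinearMap.add_apply, h.self_eq_zero] at this
  linear_combination this

theorem leibniz_right (h : IsSkewBiderivation br) (e f g : R) :
    br e (f * g) = f * br e g + g * br e f := by
  rw [h.skew, h.leibniz, h.skew e g, h.skew e f]
  ring

theorem one_left (h : IsSkewBiderivation br) (g : R) : br 1 g = 0 := by
  have := h.leibniz 1 1 g
  simp only [one_mul] at this
  linear_combination -this

theorem one_right (h : IsSkewBiderivation br) (g : R) : br g 1 = 0 := by
  rw [h.skew, h.one_left, neg_zero]

theorem algebraMap_left (h : IsSkewBiderivation br) (c : ℂ) (g : R) :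
    br (algebraMap ℂ R c) g = 0 := by
  rw [Algebra.algebraMap_eq_smul_one, map_smul, LinearMap.smul_apply, h.one_left, smul_zero]

theorem add {br' : R →ₗ[ℂ] R →ₗ[ℂ] R} (h : IsSkewBiderivation br)
    (h' : IsSkewBiderivation br') : IsSkewBiderivation (br + br') where
  self_eq_zero f := by simp [h.self_eq_zero, h'.self_eq_zero]
  leibniz f g e := by
    simp only [LinearMap.add_apply, h.leibniz, h'.leibniz]
    ring

theorem smul (h : IsSkewBiderivation br) (c : ℂ) : IsSkewBiderivation (c • br) where
  self_eq_zero f := by simp [h.self_eq_zero]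
  leibniz f g e := by
    simp only [LinearMap.smul_apply, h.leibniz, smul_add, mul_smul_comm]

end IsSkewBiderivation

/-- The Jacobiator of a bilinear operation, as a linear map in the first argument. -/
def jacobiator {R : Type*} [CommRing R] [Algebra ℂ R] (br : R →ₗ[ℂ] R →ₗ[ℂ] R) (g h : R) :
    R →ₗ[ℂ] R :=
  br.flip (br g h) + br g ∘ₗ br h + br h ∘ₗ br.flip g

/-! ### Reduction of the Jacobi identity to the variables. -/

section Jacobiator

variable {R : Type*} [CommRing R] [Algebra ℂ R] {br : R →ₗ[ℂ] R →ₗ[ℂ] R}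

theorem jacobiator_apply (f g h : R) :
    jacobiator br g h f = br f (br g h) + br g (br h f) + br h (br f g) := rfl

theorem jacobiator_rotate (f g h : R) : jacobiator br g h f = jacobiator br h f g := by
  simp only [jacobiator_apply]
  ring

theorem jacobiator_swap (hbr : IsSkewBiderivation br) (f g h : R) :
    jacobiator br g h f = -jacobiator br h g f := by
  simp only [jacobiator_apply, hbr.skew g h, hbr.skew h f, hbr.skew f g, map_neg]
  ring

/-- The products of two first brackets produced by the Leibniz rule cancel by skew-symmetry, which
leaves a derivation. -/
theorem jacobiator_mul (hbr : IsSkewBiderivation br) (f f' g h : R) :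
    jacobiator br g h (f * f') = f * jacobiator br g h f' + f' * jacobiator br g h f := by
  simp only [jacobiator_apply, hbr.leibniz, hbr.leibniz_right, map_add]
  rw [hbr.skew f g, hbr.skew f' g, hbr.skew h f, hbr.skew h f']
  simp only [map_neg]
  ring

theorem jacobiator_one (hbr : IsSkewBiderivation br) (g h : R) : jacobiator br g h 1 = 0 := by
  simp [jacobiator_apply, hbr.one_left, hbr.one_right]

theorem jacobiator_eq_zero_of_X {ι : Type*}
    {br : MvPolynomial ι ℂ →ₗ[ℂ] MvPolynomial ι ℂ →ₗ[ℂ] MvPolynomial ι ℂ}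
    (hbr : IsSkewBiderivation br) {g h : MvPolynomial ι ℂ}
    (H : ∀ p, jacobiator br g h (.X p) = 0) (f : MvPolynomial ι ℂ) :
    jacobiator br g h f = 0 := by
  induction f using MvPolynomial.induction_on with
  | C c =>
    rw [MvPolynomial.C_eq_smul_one, map_smul, jacobiator_one hbr, smul_zero]
  | add p q hp hq => rw [map_add, hp, hq, add_zero]
  | mul_X p i hp => rw [jacobiator_mul hbr, H, hp, mul_zero, mul_zero, add_zero]

/-- A skew-symmetric biderivation of a polynomial algebra is a Poisson bracket as soon as the
Jacobi identity holds for the variables. -/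
theorem IsSkewBiderivation.isPoissonBracket {ι : Type*}
    {br : MvPolynomial ι ℂ →ₗ[ℂ] MvPolynomial ι ℂ →ₗ[ℂ] MvPolynomial ι ℂ}
    (hbr : IsSkewBiderivation br)
    (H : ∀ p q r, jacobiator br (.X q) (.X r) (.X p) = 0) : IsPoissonBracket br where
  toIsSkewBiderivation := hbr
  jacobi f g h := by
    rw [← jacobiator_apply]
    refine jacobiator_eq_zero_of_X hbr (fun p => ?_) f
    rw [jacobiator_rotate]
    refine jacobiator_eq_zero_of_X hbr (fun q => ?_) g
    rw [jacobiator_rotate]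
    refine jacobiator_eq_zero_of_X hbr (fun r => ?_) h
    rw [jacobiator_rotate, H]

end Jacobiator

/-- The right-hand sides of the relations `{T i j (u), T k l (v)}` for the combination of the
Sklyanin bracket and of the second bracket with coefficients `a` and `b`. -/
noncomputable def pencil {R : Type*} [CommRing R] [Algebra ℂ R] (η α β γ δ a b : ℂ)
    (T : Fin 2 → Fin 2 → ℂ → R) (u v : ℂ) : Fin 2 → Fin 2 → Fin 2 → Fin 2 → R
  | 0, 0, 0, 0 => 0
  | 0, 1, 0, 1 => 0
  | 1, 0, 1, 0 => 0
  | 0, 1, 0, 0 =>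
    (η / (u - v)) • ((a + b * u) • (T 0 1 u * T 0 0 v) - (a + b * v) • (T 0 1 v * T 0 0 u))
      - (b * η * β / α) • (T 0 0 u * T 0 0 v)
  | 0, 0, 0, 1 =>
    (η / (u - v)) • ((a + b * v) • (T 0 1 v * T 0 0 u) - (a + b * u) • (T 0 1 u * T 0 0 v))
      + (b * η * β / α) • (T 0 0 u * T 0 0 v)
  | 1, 0, 0, 0 =>
    (-η / (u - v)) • ((a + b * u) • (T 1 0 u * T 0 0 v) - (a + b * v) • (T 1 0 v * T 0 0 u))
      + (b * η * γ / α) • (T 0 0 u * T 0 0 v)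
  | 0, 0, 1, 0 =>
    (-η / (u - v)) • ((a + b * v) • (T 1 0 v * T 0 0 u) - (a + b * u) • (T 1 0 u * T 0 0 v))
      - (b * η * γ / α) • (T 0 0 u * T 0 0 v)
  | 0, 1, 1, 0 =>
    (η / (u - v)) • ((a + b * u) • (T 1 1 u * T 0 0 v) - (a + b * v) • (T 1 1 v * T 0 0 u))
      - (b * η * δ / α) • (T 0 0 u * T 0 0 v)
  | 1, 0, 0, 1 =>
    (η / (u - v)) • ((a + b * v) • (T 1 1 v * T 0 0 u) - (a + b * u) • (T 1 1 u * T 0 0 v))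
      + (b * η * δ / α) • (T 0 0 u * T 0 0 v)
  | 0, 1, 1, 1 =>
    (-(η * (a + b * u)) / (u - v)) • (T 0 1 u * T 1 1 v - T 0 1 v * T 1 1 u)
      + (b * η) • (T 0 0 u * ((β / α) • T 1 1 v - (δ / α) • T 0 1 v))
  | 1, 1, 0, 1 =>
    (η * (a + b * v) / (u - v)) • (T 0 1 u * T 1 1 v - T 0 1 v * T 1 1 u)
      - (b * η) • (T 0 0 v * ((β / α) • T 1 1 u - (δ / α) • T 0 1 u))
  | 1, 0, 1, 1 =>
    (η * (a + b * u) / (u - v)) • (T 1 0 u * T 1 1 v - T 1 0 v * T 1 1 u)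
      - (b * η) • (T 0 0 u * ((γ / α) • T 1 1 v - (δ / α) • T 1 0 v))
  | 1, 1, 1, 0 =>
    (-(η * (a + b * v)) / (u - v)) • (T 1 0 u * T 1 1 v - T 1 0 v * T 1 1 u)
      + (b * η) • (T 0 0 v * ((γ / α) • T 1 1 u - (δ / α) • T 1 0 u))
  | 0, 0, 1, 1 =>
    (η * (a + b * u) / (u - v)) • (T 1 0 u * T 0 1 v - T 1 0 v * T 0 1 u)
      - (b * η) • (T 0 0 u * ((γ / α) • T 0 1 v - (β / α) • T 1 0 v))
  | 1, 1, 0, 0 =>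
    (-(η * (a + b * v)) / (u - v)) • (T 1 0 u * T 0 1 v - T 1 0 v * T 0 1 u)
      + (b * η) • (T 0 0 v * ((γ / α) • T 0 1 u - (β / α) • T 1 0 u))
  | 1, 1, 1, 1 =>
    (b * η * γ / α) • (T 1 1 u * T 0 1 v - T 1 1 v * T 0 1 u)
      - (b * η * β / α) • (T 1 1 u * T 1 0 v - T 1 1 v * T 1 0 u)
      + (b * η * δ / α) • (T 0 1 u * T 1 0 v - T 0 1 v * T 1 0 u)

/-- The bracket `br` satisfies the relations of the pencil for the functions `T i j`. -/
def SatisfiesPencil {R : Type*} [CommRing R] [Algebra ℂ R] (η α β γ δ a b : ℂ)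
    (T : Fin 2 → Fin 2 → ℂ → R) (br : R →ₗ[ℂ] R →ₗ[ℂ] R) : Prop :=
  ∀ i j k l u v, u ≠ v → br (T i j u) (T k l v) = pencil η α β γ δ a b T u v i j k l

/-- A rotation and a transposition generate all permutations of three letters. For the four matrix
entries this cuts 64 triples down to 20. -/
theorem forall_triple_of_sorted {ι : Type*} (rank : ι → ℕ) {P : ι → ι → ι → Prop}
    (rotate : ∀ p q r, P p q r → P q r p) (swap : ∀ p q r, P p q r → P p r q)
    (sorted : ∀ p q r, rank p ≤ rank q → rank q ≤ rank r → P p q r) (p q r : ι) : P p q r := by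
  rcases le_total (rank p) (rank q) with h₁ | h₁ <;>
    rcases le_total (rank q) (rank r) with h₂ | h₂ <;>
    rcases le_total (rank p) (rank r) with h₃ | h₃
  · exact sorted _ _ _ h₁ h₂
  · exact sorted _ _ _ h₁ h₂
  · exact swap _ _ _ (sorted _ _ _ h₃ h₂)
  · exact rotate _ _ _ (sorted _ _ _ h₃ h₁)
  · exact swap _ _ _ (rotate _ _ _ (sorted _ _ _ h₁ h₃))
  · exact rotate _ _ _ (rotate _ _ _ (sorted _ _ _ h₂ h₃))
  · exact rotate _ _ _ (swap _ _ _ (sorted _ _ _ h₂ h₁))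
  · exact rotate _ _ _ (swap _ _ _ (sorted _ _ _ h₂ h₁))

/-! ### The Jacobi identity at three distinct parameters. -/

section Jacobi

variable {R : Type*} [CommRing R] [Algebra ℂ R] {η α β γ δ a b : ℂ} {T : Fin 2 → Fin 2 → ℂ → R}
  {br : R →ₗ[ℂ] R →ₗ[ℂ] R}

set_option maxHeartbeats 8000000 in
-- Twenty identities of rational functions are checked by normalization.
theorem SatisfiesPencil.jacobiator_sorted (hα : α ≠ 0) (hbr : IsSkewBiderivation br)
    (h : SatisfiesPencil η α β γ δ a b T br) (ε : R →ₐ[ℂ] ℂ) :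
    ∀ i j k l p q : Fin 2, 2 * i.val + j.val ≤ 2 * k.val + l.val →
      2 * k.val + l.val ≤ 2 * p.val + q.val →
      ∀ u v w : ℂ, u ≠ v → v ≠ w → w ≠ u →
        ε (jacobiator br (T k l v) (T p q w) (T i j u)) = 0 := by
  -- Orients all denominators as `u - v`, `v - w`, `w - u`. The character `ε` turns the entries into
  -- complex numbers, so that field arithmetic applies.
  have e (x y c : ℂ) : c / (x - y) = -(c / (y - x)) := by rw [← neg_sub y x, div_neg]
  simp only [Fin.forall_fin_two]
  and_intros
  all_goals
    intro h₁ h₂ u v w huv hvw hwu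
    first
    | exact absurd h₁ (by decide)
    | exact absurd h₂ (by decide)
    | simp only [jacobiator_apply, h _ _ _ _ _ _ huv, h _ _ _ _ _ _ hvw, h _ _ _ _ _ _ hwu,
        h _ _ _ _ _ _ huv.symm, h _ _ _ _ _ _ hvw.symm, h _ _ _ _ _ _ hwu.symm, pencil,
        map_add, map_sub, map_smul, map_zero, map_mul, hbr.leibniz_right, smul_eq_mul,
        add_zero]
      try
        have huv' := sub_ne_zero.2 huv
        have hvw' := sub_ne_zero.2 hvw
        have hwu' := sub_ne_zero.2 hwu
        simp only [e v u, e w v, e u w]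
        field_simp
        ring

theorem SatisfiesPencil.jacobiator_eq_zero (hα : α ≠ 0) (hbr : IsSkewBiderivation br)
    (h : SatisfiesPencil η α β γ δ a b T br) (ε : R →ₐ[ℂ] ℂ) (p q r : Fin 2 × Fin 2) :
    ∀ u v w : ℂ, u ≠ v → v ≠ w → w ≠ u →
      ε (jacobiator br (T q.1 q.2 v) (T r.1 r.2 w) (T p.1 p.2 u)) = 0 := by
  refine forall_triple_of_sorted (fun p : Fin 2 × Fin 2 => 2 * p.1.val + p.2.val)
    (P := fun p q r => ∀ u v w : ℂ, u ≠ v → v ≠ w → w ≠ u →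
      ε (jacobiator br (T q.1 q.2 v) (T r.1 r.2 w) (T p.1 p.2 u)) = 0)
    (fun p q r H u v w huv hvw hwu => ?_) (fun p q r H u v w huv hvw hwu => ?_)
    (fun p q r h₁ h₂ => h.jacobiator_sorted hα hbr ε _ _ _ _ _ _ h₁ h₂) p q r
  · rw [← jacobiator_rotate]
    exact H w u v hwu huv hvw
  · rw [jacobiator_swap hbr, map_neg, H u w v hwu.symm hvw.symm huv.symm, neg_zero]

end Jacobi
-- Interpolation from parameter values to coefficients.
section Interpolation

variable {n : ℕ} {L : Matrix (Fin 2) (Fin 2) ℂ}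

/-- The values of `T(u)` at all but finitely many `u` determine the coefficients of `T`. -/
theorem map_X_eq_zero_of_polyMatrix {n : ℕ} (φ : CoeffAlgebra n →ₗ[ℂ] CoeffAlgebra n)
    (hφ : φ 1 = 0) {i j : Fin 2} (S : Finset ℂ)
    (H : ∀ u ∉ S, φ (polyMatrix n L u i j) = 0) (k : Fin n) : φ (.X (i, j, k)) = 0 := by
  let P : Polynomial (CoeffAlgebra n) :=
    ∑ k : Fin n, Polynomial.monomial (n - 1 - (k : ℕ)) (φ (.X (i, j, k)))
  have hP : P = 0 := by
    refine Polynomial.eq_zero_of_infinite_isRoot P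
      (Set.Infinite.mono (s := Set.image MvPolynomial.C (S : Set ℂ)ᶜ) ?_
        ((S.finite_toSet.infinite_compl).image (MvPolynomial.C_injective _ _).injOn))
    rintro _ ⟨u, hu, rfl⟩
    have := H u (by simpa using hu)
    simp only [polyMatrix, Matrix.of_apply, map_add, map_sum, MvPolynomial.C_mul', map_smul] at this
    rw [MvPolynomial.C_eq_smul_one, map_smul, hφ, smul_zero, zero_add] at this
    simp only [Set.mem_ofPred_eq, Polynomial.IsRoot, P, Polynomial.eval_finsetSum,
      Polynomial.eval_monomial]
    rw [← this]
    refine Finset.sum_congr rfl fun k _ => ?_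
    rw [← map_pow, mul_comm, MvPolynomial.C_mul']
  have hk := congrArg (fun Q => Polynomial.coeff Q (n - 1 - (k : ℕ))) hP
  simp only [P, Polynomial.finsetSum_coeff, Polynomial.coeff_monomial, Polynomial.coeff_zero] at hk
  rw [Finset.sum_eq_single k] at hk
  · simpa using hk
  -- The exponents `n - 1 - k` are distinct for `k < n`, so the truncated subtraction merges no
  -- coefficients.
  · intro l _ hl
    refine if_neg fun h => hl (Fin.ext ?_)
    omega
  · simp

theorem bracket_polyMatrix {br : CoeffBracket n} (hbr : IsSkewBiderivation br) (i j k l : Fin 2)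
    (u v : ℂ) :
    br (polyMatrix n L u i j) (polyMatrix n L v k l) =
      ∑ s : Fin n, ∑ t : Fin n, (u ^ (n - 1 - (s : ℕ)) * v ^ (n - 1 - (t : ℕ))) •
        br (.X (i, j, s)) (.X (k, l, t)) := by
  have h₁ : ∀ (c : ℂ) g, br (MvPolynomial.C c) g = 0 := hbr.algebraMap_left
  have h₂ : ∀ (c : ℂ) g, br g (MvPolynomial.C c) = 0 := fun c g => by rw [hbr.skew, h₁, neg_zero]
  simp only [polyMatrix, Matrix.of_apply, map_add, map_sum, MvPolynomial.C_mul', map_smul, h₁, h₂,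
    zero_add, LinearMap.add_apply, LinearMap.sum_apply, LinearMap.smul_apply, Finset.smul_sum,
    smul_zero, Finset.sum_const_zero]
  rw [Finset.sum_comm]
  refine Finset.sum_congr rfl fun s _ => Finset.sum_congr rfl fun t _ => ?_
  rw [mul_smul, smul_comm]

/-- A skew-symmetric biderivation is determined by its values on the variables. -/
theorem IsSkewBiderivation.eq_zero_of_X {ι : Type*}
    {br : MvPolynomial ι ℂ →ₗ[ℂ] MvPolynomial ι ℂ →ₗ[ℂ] MvPolynomial ι ℂ}
    (hbr : IsSkewBiderivation br) (H : ∀ p q, br (.X p) (.X q) = 0) : br = 0 := by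
  have left : ∀ g, (∀ p, br (.X p) g = 0) → ∀ f, br f g = 0 := by
    intro g hg f
    induction f using MvPolynomial.induction_on with
    | C c => exact hbr.algebraMap_left c g
    | add p q hp hq => rw [map_add, LinearMap.add_apply, hp, hq, add_zero]
    | mul_X p i hp => rw [hbr.leibniz, hg, hp, mul_zero, mul_zero, add_zero]
  refine LinearMap.ext fun f => LinearMap.ext fun g => ?_
  refine left g (fun p => ?_) f
  rw [hbr.skew, left _ (fun q => H q p), neg_zero]

theorem IsSkewBiderivation.ext_polyMatrix {br br' : CoeffBracket n} (hbr : IsSkewBiderivation br)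
    (hbr' : IsSkewBiderivation br')
    (H : ∀ i j k l u v, u ≠ v → br (polyMatrix n L u i j) (polyMatrix n L v k l) =
      br' (polyMatrix n L u i j) (polyMatrix n L v k l)) : br = br' := by
  have hd : IsSkewBiderivation (br + (-1 : ℂ) • br') := hbr.add (hbr'.smul _)
  have hz : br + (-1 : ℂ) • br' = 0 := by
    refine hd.eq_zero_of_X fun ⟨i, j, s⟩ ⟨k, l, t⟩ => ?_
    refine map_X_eq_zero_of_polyMatrix (L := L) ((br + (-1 : ℂ) • br') (.X (i, j, s)))
      (hd.one_right _) ∅ (fun v _ => ?_) t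
    refine map_X_eq_zero_of_polyMatrix (L := L)
      ((br + (-1 : ℂ) • br').flip (polyMatrix n L v k l)) (hd.one_left _) {v} (fun u hu => ?_) s
    simp [H i j k l u v (by simpa using hu)]
  refine LinearMap.ext fun f => LinearMap.ext fun g => ?_
  have := LinearMap.congr_fun₂ hz f g
  simpa [add_neg_eq_zero] using this

theorem SatisfiesPencil.isPoissonBracket {η α β γ δ a b : ℂ} (hα : α ≠ 0) {br : CoeffBracket n}
    (hbr : IsSkewBiderivation br)
    (h : SatisfiesPencil η α β γ δ a b (fun i j u => polyMatrix n L u i j) br) :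
    IsPoissonBracket br := by
  have key := h.jacobiator_eq_zero hα hbr
  refine hbr.isPoissonBracket fun ⟨i, j, s⟩ ⟨k, l, t⟩ ⟨p, q, r⟩ => ?_
  -- The parameters are freed one at a time, each avoiding those already chosen, so the three stay
  -- distinct.
  refine map_X_eq_zero_of_polyMatrix (L := L) _ (jacobiator_one hbr _ _) ∅ (fun u _ => ?_) s
  rw [jacobiator_rotate, jacobiator_rotate]
  refine map_X_eq_zero_of_polyMatrix (L := L) _ (jacobiator_one hbr _ _) {u} (fun w hw => ?_) r
  rw [jacobiator_rotate, jacobiator_rotate]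
  refine map_X_eq_zero_of_polyMatrix (L := L) _ (jacobiator_one hbr _ _) {u, w} (fun v hv => ?_) t
  simp only [Finset.mem_insert, Finset.mem_singleton, not_or] at hw hv
  refine MvPolynomial.funext fun x => ?_
  rw [map_zero, jacobiator_rotate, jacobiator_rotate]
  exact key (MvPolynomial.aeval x) (i, j) (k, l) (p, q) u v w (Ne.symm hv.1) hv.2 hw

end Interpolation
-- Brackets with prescribed values, and polynomiality of Bezoutians.
section Existence

/-- The bilinear biderivation of a polynomial algebra with given values on the variables. -/
noncomputable def bracketOf {ι : Type*} [Fintype ι] (P : ι → ι → MvPolynomial ι ℂ) :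
    MvPolynomial ι ℂ →ₗ[ℂ] MvPolynomial ι ℂ →ₗ[ℂ] MvPolynomial ι ℂ :=
  LinearMap.mk₂ ℂ (fun f g => ∑ p, ∑ q, MvPolynomial.pderiv p f * MvPolynomial.pderiv q g * P p q)
    (fun f f' g => by simp only [map_add, add_mul, Finset.sum_add_distrib])
    (fun c f g => by simp only [Derivation.map_smul, smul_mul_assoc, Finset.smul_sum])
    (fun f g g' => by simp only [map_add, mul_add, add_mul, Finset.sum_add_distrib])
    (fun c f g => by simp only [Derivation.map_smul, smul_mul_assoc, mul_smul_comm, Finset.smul_sum])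

theorem bracketOf_apply {ι : Type*} [Fintype ι] (P : ι → ι → MvPolynomial ι ℂ)
    (f g : MvPolynomial ι ℂ) :
    bracketOf P f g = ∑ p, ∑ q, MvPolynomial.pderiv p f * MvPolynomial.pderiv q g * P p q := rfl

theorem bracketOf_X {ι : Type*} [Fintype ι] (P : ι → ι → MvPolynomial ι ℂ) (p q : ι) :
    bracketOf P (.X p) (.X q) = P p q := by
  classical
  rw [bracketOf_apply, Finset.sum_eq_single p, Finset.sum_eq_single q]
  · simp
  · intro r _ hr
    simp [MvPolynomial.pderiv_X_of_ne hr.symm]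
  · simp
  · intro r _ hr
    simp [MvPolynomial.pderiv_X_of_ne hr.symm]
  · simp

theorem isSkewBiderivation_bracketOf {ι : Type*} [Fintype ι] {P : ι → ι → MvPolynomial ι ℂ}
    (hP : ∀ p q, P p q = -P q p) : IsSkewBiderivation (bracketOf P) where
  self_eq_zero f := by
    have h : bracketOf P f f = -bracketOf P f f := by
      conv_lhs => rw [bracketOf_apply, Finset.sum_comm]
      simp only [bracketOf_apply, ← Finset.sum_neg_distrib]
      refine Finset.sum_congr rfl fun p _ => Finset.sum_congr rfl fun q _ => ?_
      rw [hP q p]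
      ring
    exact self_eq_neg.1 h
  leibniz f g h := by
    simp only [bracketOf_apply, Derivation.leibniz, smul_eq_mul, Finset.mul_sum,
      ← Finset.sum_add_distrib]
    refine Finset.sum_congr rfl fun p _ => Finset.sum_congr rfl fun q _ => ?_
    ring

variable {R : Type*} [CommRing R] [Algebra ℂ R]

/-- Polynomial functions `ℂ → R` of degree less than `d`. -/
def polyFun (R : Type*) [CommRing R] [Algebra ℂ R] (d : ℕ) : Submodule ℂ (ℂ → R) :=
  Submodule.span ℂ {f | ∃ i < d, ∃ r : R, f = fun u => u ^ i • r}

theorem monomial_mem_polyFun {d i : ℕ} (hi : i < d) (r : R) :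
    (fun u : ℂ => u ^ i • r) ∈ polyFun R d :=
  Submodule.subset_span ⟨i, hi, r, rfl⟩

theorem polyFun_mono {d e : ℕ} (h : d ≤ e) : polyFun R d ≤ polyFun R e :=
  Submodule.span_mono fun _ ⟨i, hi, r, hf⟩ => ⟨i, hi.trans_le h, r, hf⟩

theorem smul_mem_polyFun_succ {d : ℕ} {f : ℂ → R} (hf : f ∈ polyFun R d) :
    (fun u : ℂ => u • f u) ∈ polyFun R (d + 1) := by
  induction hf using Submodule.span_induction with
  | mem f h =>
    obtain ⟨i, hi, r, rfl⟩ := h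
    convert monomial_mem_polyFun (Nat.succ_lt_succ hi) r using 2 with u
    rw [smul_smul, ← pow_succ']
  | zero =>
    simp only [Pi.zero_apply, smul_zero]
    exact (polyFun R (d + 1)).zero_mem
  | add f g _ _ hf hg => simpa only [Pi.add_apply, smul_add] using! add_mem hf hg
  | smul c f _ hf =>
    simpa only [Pi.smul_apply, smul_comm _ c] using! (polyFun R (d + 1)).smul_mem c hf

/-- Functions of two variables which off the diagonal are polynomials of degree less than `n` in
each variable. -/
def biPolyFun (R : Type*) [CommRing R] [Algebra ℂ R] (n : ℕ) : Submodule ℂ (ℂ → ℂ → R) where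
  carrier := {F | ∃ M : Fin n → Fin n → R, ∀ u v, u ≠ v → F u v =
    ∑ s : Fin n, ∑ t : Fin n, (u ^ (n - 1 - (s : ℕ)) * v ^ (n - 1 - (t : ℕ))) • M s t}
  add_mem' := by
    rintro F G ⟨M, hM⟩ ⟨N, hN⟩
    refine ⟨M + N, fun u v h => ?_⟩
    simp only [Pi.add_apply, hM u v h, hN u v h, smul_add, Finset.sum_add_distrib]
  zero_mem' := ⟨0, by simp⟩
  smul_mem' := by
    rintro c F ⟨M, hM⟩
    refine ⟨c • M, fun u v h => ?_⟩
    simp only [Pi.smul_apply, hM u v h, Finset.smul_sum, smul_comm c]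

variable {n : ℕ}

theorem biPolyFun_congr {F G : ℂ → ℂ → R} (hG : G ∈ biPolyFun R n)
    (h : ∀ u v, u ≠ v → F u v = G u v) : F ∈ biPolyFun R n := by
  obtain ⟨M, hM⟩ := hG
  exact ⟨M, fun u v huv => (h u v huv).trans (hM u v huv)⟩

theorem biPolyFun_swap {F : ℂ → ℂ → R} (hF : F ∈ biPolyFun R n) :
    (fun u v => F v u) ∈ biPolyFun R n := by
  obtain ⟨M, hM⟩ := hF
  refine ⟨fun s t => M t s, fun u v huv => ?_⟩
  beta_reduce
  rw [hM v u huv.symm, Finset.sum_comm]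
  simp only [mul_comm]

theorem monomial_mem_biPolyFun {i j : ℕ} (hi : i < n) (hj : j < n) (r : R) :
    (fun u v : ℂ => (u ^ i * v ^ j) • r) ∈ biPolyFun R n := by
  let s₀ : Fin n := ⟨n - 1 - i, by omega⟩
  let t₀ : Fin n := ⟨n - 1 - j, by omega⟩
  refine ⟨fun s t => if s = s₀ ∧ t = t₀ then r else 0, fun u v _ => ?_⟩
  rw [Finset.sum_eq_single s₀, Finset.sum_eq_single t₀]
  · simp only [and_self, if_true, s₀, t₀]
    rw [Nat.sub_sub_self (by omega), Nat.sub_sub_self (by omega)]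
  · intro t _ ht
    simp [ht]
  · simp
  · intro s _ hs
    simp [hs]
  · simp

theorem mul_mem_biPolyFun {f g : ℂ → R} (hf : f ∈ polyFun R n) (hg : g ∈ polyFun R n) :
    (fun u v => f u * g v) ∈ biPolyFun R n := by
  induction hf using Submodule.span_induction with
  | mem f h =>
    obtain ⟨i, hi, r, rfl⟩ := h
    induction hg using Submodule.span_induction with
    | mem g h =>
      obtain ⟨j, hj, r', rfl⟩ := h
      convert monomial_mem_biPolyFun hi hj (r * r') using 3
      rw [smul_mul_smul_comm]
    | zero =>
      simp only [Pi.zero_apply, mul_zero]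
      exact (biPolyFun R n).zero_mem
    | add g g' _ _ hg hg' => simpa only [Pi.add_apply, mul_add] using! add_mem hg hg'
    | smul c g _ hg =>
      simpa only [Pi.smul_apply, mul_smul_comm] using! (biPolyFun R n).smul_mem c hg
  | zero =>
    simp only [Pi.zero_apply, zero_mul]
    exact (biPolyFun R n).zero_mem
  | add f f' _ _ hf hf' => simpa only [Pi.add_apply, add_mul] using! add_mem hf hf'
  | smul c f _ hf => simpa only [Pi.smul_apply, smul_mul_assoc] using! (biPolyFun R n).smul_mem c hf

/-- The Bezoutian `(f(u) g(v) - f(v) g(u)) / (u - v)`. -/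
noncomputable def bezoutian (f g : ℂ → R) (u v : ℂ) : R :=
  (u - v)⁻¹ • (f u * g v - f v * g u)

/-- The numerator is `(u * v) ^ i * (u ^ k - v ^ k)`, and the geometric sum cancels `u - v`, leaving
exponents at most `i + k - 1`. -/
theorem bezoutian_monomial_mem {i k : ℕ} (hi : i + k ≤ n) (r : R) :
    (fun u v : ℂ => ((u - v)⁻¹ * (u ^ (i + k) * v ^ i - v ^ (i + k) * u ^ i)) • r) ∈
      biPolyFun R n := by
  have hsum : (∑ l ∈ Finset.range k, fun u v : ℂ => (u ^ (i + l) * v ^ (i + (k - 1 - l))) • r) ∈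
      biPolyFun R n :=
    Submodule.sum_mem _ fun l hl => by
      have := Finset.mem_range.1 hl
      exact monomial_mem_biPolyFun (by omega) (by omega) r
  refine biPolyFun_congr hsum fun u v huv => ?_
  have h := (Commute.all u v).geom_sum₂_mul k
  have huv' := sub_ne_zero.2 huv
  simp only [Finset.sum_apply, ← Finset.sum_smul]
  congr 1
  rw [inv_mul_eq_iff_eq_mul₀ huv']
  have e : ∑ l ∈ Finset.range k, u ^ (i + l) * v ^ (i + (k - 1 - l)) =
      u ^ i * v ^ i * ∑ l ∈ Finset.range k, u ^ l * v ^ (k - 1 - l) := by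
    rw [Finset.mul_sum]
    refine Finset.sum_congr rfl fun l _ => ?_
    ring
  rw [e]
  linear_combination (-(u ^ i * v ^ i)) * h

/-- Division by `u - v` lowers the degree bound in each variable by one; bilinearity reduces this to
monomials. -/
theorem bezoutian_mem {f g : ℂ → R} (hf : f ∈ polyFun R (n + 1)) (hg : g ∈ polyFun R (n + 1)) :
    bezoutian f g ∈ biPolyFun R n := by
  induction hf using Submodule.span_induction with
  | mem f h =>
    obtain ⟨i, hi, r, rfl⟩ := h
    induction hg using Submodule.span_induction with
    | mem g h =>
      obtain ⟨j, hj, r', rfl⟩ := h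
      have e : bezoutian (fun u => u ^ i • r) (fun u => u ^ j • r') = fun u v : ℂ =>
          ((u - v)⁻¹ * (u ^ i * v ^ j - v ^ i * u ^ j)) • (r * r') := by
        funext u v
        simp only [bezoutian, smul_mul_smul_comm, ← sub_smul, smul_smul]
      rw [e]
      rcases le_total j i with hji | hij
      · obtain ⟨k, rfl⟩ := Nat.exists_eq_add_of_le hji
        exact bezoutian_monomial_mem (by omega) _
      · obtain ⟨k, rfl⟩ := Nat.exists_eq_add_of_le hij
        convert neg_mem (bezoutian_monomial_mem (n := n) (i := i) (k := k) (by omega) (r * r'))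
          using 1
        funext u v
        simp only [Pi.neg_apply, ← neg_smul]
        congr 1
        ring
    | zero =>
      convert (biPolyFun R n).zero_mem using 1
      funext u v
      simp [bezoutian]
    | add g g' _ _ hg hg' =>
      convert add_mem hg hg' using 1
      funext u v
      simp only [bezoutian, Pi.add_apply, ← smul_add]
      congr 1
      ring
    | smul c g _ hg =>
      convert (biPolyFun R n).smul_mem c hg using 1
      funext u v
      simp only [bezoutian, Pi.smul_apply, mul_smul_comm, ← smul_sub, smul_comm c]
  | zero =>
    convert (biPolyFun R n).zero_mem using 1
    funext u v
    simp [bezoutian]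
  | add f f' _ _ hf hf' =>
    convert add_mem hf hf' using 1
    funext u v
    simp only [bezoutian, Pi.add_apply, ← smul_add]
    congr 1
    ring
  | smul c f _ hf =>
    convert (biPolyFun R n).smul_mem c hf using 1
    funext u v
    simp only [bezoutian, Pi.smul_apply, smul_mul_assoc, ← smul_sub, smul_comm c]

variable (L : Matrix (Fin 2) (Fin 2) ℂ)

theorem polyMatrix_mem_polyFun (i j : Fin 2) :
    (fun u => polyMatrix n L u i j) ∈ polyFun (CoeffAlgebra n) (n + 1) := by
  have h : (fun u => polyMatrix n L u i j) =
      (fun u : ℂ => u ^ n • (MvPolynomial.C (L i j) : CoeffAlgebra n)) +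
        ∑ k : Fin n, fun u : ℂ => u ^ (n - 1 - (k : ℕ)) • MvPolynomial.X (i, j, k) := by
    funext u
    simp only [polyMatrix, Matrix.of_apply, Pi.add_apply, Finset.sum_apply, MvPolynomial.C_mul']
    rw [mul_comm, map_mul, MvPolynomial.C_mul']
  rw [h]
  exact add_mem (monomial_mem_polyFun n.lt_succ_self _)
    (Submodule.sum_mem _ fun k _ => monomial_mem_polyFun (by omega) _)

/-- The entry `(i, j)` of `T(u)` minus the multiple of `A(u)` with the same leading term. -/
noncomputable def reducedEntry (n : ℕ) (L : Matrix (Fin 2) (Fin 2) ℂ) (i j : Fin 2) (u : ℂ) :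
    CoeffAlgebra n :=
  polyMatrix n L u i j - (L i j / L 0 0) • polyMatrix n L u 0 0

theorem reducedEntry_mem_polyFun (hL : L 0 0 ≠ 0) (i j : Fin 2) :
    reducedEntry n L i j ∈ polyFun (CoeffAlgebra n) n := by
  have h : reducedEntry n L i j =
      (∑ k : Fin n, fun u : ℂ => u ^ (n - 1 - (k : ℕ)) •
        (MvPolynomial.X (i, j, k) : CoeffAlgebra n)) -
      (L i j / L 0 0) • ∑ k : Fin n, fun u : ℂ => u ^ (n - 1 - (k : ℕ)) •
        (MvPolynomial.X (0, 0, k) : CoeffAlgebra n) := by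
    funext u
    simp only [reducedEntry, polyMatrix, Matrix.of_apply, Pi.sub_apply, Pi.smul_apply,
      Finset.sum_apply, MvPolynomial.C_mul', smul_add]
    have e : (L i j / L 0 0) • (MvPolynomial.C (L 0 0 * u ^ n) : CoeffAlgebra n) =
        MvPolynomial.C (L i j * u ^ n) := by
      rw [MvPolynomial.smul_eq_C_mul, ← map_mul]
      congr 1
      field_simp
    rw [e]
    abel
  rw [h]
  exact sub_mem (Submodule.sum_mem _ fun k _ => monomial_mem_polyFun (by omega) _)
    ((polyFun _ n).smul_mem _ (Submodule.sum_mem _ fun k _ => monomial_mem_polyFun (by omega) _))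

end Existence
-- The pencil of relations: existence, uniqueness, and its two generators.
section Pencil

variable {n : ℕ} {η α β γ δ a b : ℂ}

theorem pencil_skew {R : Type*} [CommRing R] [Algebra ℂ R] (T : Fin 2 → Fin 2 → ℂ → R)
    (i j k l : Fin 2) {u v : ℂ} :
    pencil η α β γ δ a b T u v i j k l = -pencil η α β γ δ a b T v u k l i j := by
  have e (c : ℂ) : c / (v - u) = -(c / (u - v)) := by rw [← neg_sub u v, div_neg]
  revert i j k l
  simp only [Fin.forall_fin_two]
  and_intros <;> simp only [pencil, e, neg_zero, mul_comm (T 0 0 v) (T 0 0 u)] <;> module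

theorem pencil_linear {R : Type*} [CommRing R] [Algebra ℂ R] (T : Fin 2 → Fin 2 → ℂ → R)
    (i j k l : Fin 2) {u v : ℂ} :
    pencil η α β γ δ a b T u v i j k l =
      a • pencil η α β γ δ 1 0 T u v i j k l + b • pencil η α β γ δ 0 1 T u v i j k l := by
  revert i j k l
  simp only [Fin.forall_fin_two]
  and_intros <;> simp only [pencil] <;> module

theorem pencil_mem_biPolyFun_of_le (hα : α ≠ 0) (i j k l : Fin 2)
    (h : 2 * i.val + j.val ≤ 2 * k.val + l.val) :
    (fun u v => pencil η α β γ δ a b (fun i j u => polyMatrix n !![α, β; γ, δ] u i j) u v i j k l) ∈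
      biPolyFun (CoeffAlgebra n) n := by
  let L : Matrix (Fin 2) (Fin 2) ℂ := !![α, β; γ, δ]
  let A : ℂ → CoeffAlgebra n := fun u => polyMatrix n L u 0 0
  let B := reducedEntry n L 0 1
  let C := reducedEntry n L 1 0
  let D := reducedEntry n L 1 1
  -- The weight raises the degree by at most one, which reduced entries can afford: a Bezoutian with
  -- `W f` still has admissible degree.
  let W (f : ℂ → CoeffAlgebra n) (u : ℂ) : CoeffAlgebra n := (a + b * u) • f u
  have hA : A ∈ polyFun (CoeffAlgebra n) (n + 1) := polyMatrix_mem_polyFun L 0 0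
  have hL : L 0 0 ≠ 0 := hα
  have hB : B ∈ polyFun (CoeffAlgebra n) n := reducedEntry_mem_polyFun L hL 0 1
  have hC : C ∈ polyFun (CoeffAlgebra n) n := reducedEntry_mem_polyFun L hL 1 0
  have hD : D ∈ polyFun (CoeffAlgebra n) n := reducedEntry_mem_polyFun L hL 1 1
  have lift {f : ℂ → CoeffAlgebra n} (hf : f ∈ polyFun (CoeffAlgebra n) n) :
      f ∈ polyFun (CoeffAlgebra n) (n + 1) := polyFun_mono n.le_succ hf
  have hW {f : ℂ → CoeffAlgebra n} (hf : f ∈ polyFun (CoeffAlgebra n) n) :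
      W f ∈ polyFun (CoeffAlgebra n) (n + 1) := by
    have : W f = a • f + b • fun u => u • f u := by
      funext u
      simp only [W, Pi.add_apply, Pi.smul_apply, add_smul, mul_smul]
    rw [this]
    exact add_mem (Submodule.smul_mem _ _ (lift hf))
      (Submodule.smul_mem _ _ (smul_mem_polyFun_succ hf))
  have eB u : polyMatrix n !![α, β; γ, δ] u 0 1 = B u + (β / α) • A u := by
    simp [B, A, L, reducedEntry]
  have eC u : polyMatrix n !![α, β; γ, δ] u 1 0 = C u + (γ / α) • A u := by
    simp [C, A, L, reducedEntry]
  have eD u : polyMatrix n !![α, β; γ, δ] u 1 1 = D u + (δ / α) • A u := by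
    simp [D, A, L, reducedEntry]
  have eA u : polyMatrix n !![α, β; γ, δ] u 0 0 = A u := rfl
  let V := biPolyFun (CoeffAlgebra n) n
  have hmul {f g : ℂ → CoeffAlgebra n} (hf : f ∈ polyFun (CoeffAlgebra n) n)
      (hg : g ∈ polyFun (CoeffAlgebra n) n) : (fun u v => f u * g v) ∈ V := mul_mem_biPolyFun hf hg
  have hbez {f g : ℂ → CoeffAlgebra n} (hf : f ∈ polyFun (CoeffAlgebra n) n)
      (hg : g ∈ polyFun (CoeffAlgebra n) (n + 1)) : bezoutian (W f) g ∈ V := bezoutian_mem (hW hf) hg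
  have hanti {f g : ℂ → CoeffAlgebra n} (hf : f ∈ polyFun (CoeffAlgebra n) n)
      (hg : g ∈ polyFun (CoeffAlgebra n) n) : (fun u v => f u * g v - f v * g u) ∈ V := by
    simpa only [mul_comm] using! sub_mem (hmul hf hg) (biPolyFun_swap (hmul hf hg))
  -- With `B + (β / α) • A` for the full entry, the weights differ by `b * (u - v)`, and the
  -- resulting `A u * A v` term cancels the correction.
  have mAB := V.smul_mem (-η) (hbez hB hA)
  have mAC := V.smul_mem η (hbez hC hA)
  have mBC := V.smul_mem η (hbez hD hA)
  -- The weight `a + b * u` multiplies both products here; moving the second to `a + b * v` costs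
  -- the term `b • (D u * B v)`.
  have mBD := V.smul_mem (-η) (sub_mem (add_mem (sub_mem (hbez hB (lift hD))
    (V.smul_mem b (hmul hD hB))) (V.smul_mem (δ / α) (hbez hB hA)))
    (V.smul_mem (β / α) (hbez hD hA)))
  have mCD := V.smul_mem η (sub_mem (add_mem (sub_mem (hbez hC (lift hD))
    (V.smul_mem b (hmul hD hC))) (V.smul_mem (δ / α) (hbez hC hA)))
    (V.smul_mem (γ / α) (hbez hD hA)))
  have mAD := V.smul_mem η (sub_mem (add_mem (sub_mem (hbez hC (lift hB))
    (V.smul_mem b (hmul hB hC))) (V.smul_mem (β / α) (hbez hC hA)))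
    (V.smul_mem (γ / α) (hbez hB hA)))
  -- This is a multiple of the determinant with rows `(β, γ, δ)` and `(B, C, D)` at `u` and at `v`,
  -- unchanged when multiples of the first row are added to the others.
  have mDD := add_mem (sub_mem (V.smul_mem (b * η * γ / α) (hanti hD hB))
    (V.smul_mem (b * η * β / α) (hanti hD hC))) (V.smul_mem (b * η * δ / α) (hanti hB hC))
  clear_value A B C D
  have reduce {F G : ℂ → ℂ → CoeffAlgebra n} (hG : G ∈ V)
      (h : ∀ x u v, u ≠ v → MvPolynomial.eval x (F u v) = MvPolynomial.eval x (G u v)) : F ∈ V :=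
    biPolyFun_congr hG fun u v huv => MvPolynomial.funext fun x => h x u v huv
  revert i j k l
  simp only [Fin.forall_fin_two]
  and_intros
  all_goals try exact fun h => absurd h (by decide)
  all_goals try exact fun _ => V.zero_mem
  all_goals
    intro _
    simp only [pencil, eA, eB, eC, eD]
  on_goal 1 => refine reduce mAB ?_
  on_goal 2 => refine reduce mAC ?_
  on_goal 3 => refine reduce mAD ?_
  on_goal 4 => refine reduce mBC ?_
  on_goal 5 => refine reduce mBD ?_
  on_goal 6 => refine reduce mCD ?_
  on_goal 7 => refine reduce mDD ?_
  all_goals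
    intro x u v huv
    have huv' := sub_ne_zero.2 huv
    simp only [bezoutian, W, Pi.add_apply, Pi.sub_apply, Pi.smul_apply, map_add, map_sub,
      map_mul, MvPolynomial.smul_eval]
    field_simp
    try ring

theorem pencil_mem_biPolyFun (hα : α ≠ 0) (i j k l : Fin 2) :
    (fun u v => pencil η α β γ δ a b (fun i j u => polyMatrix n !![α, β; γ, δ] u i j) u v i j k l) ∈
      biPolyFun (CoeffAlgebra n) n := by
  rcases le_total (2 * i.val + j.val) (2 * k.val + l.val) with h | h
  · exact pencil_mem_biPolyFun_of_le hα i j k l h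
  · refine biPolyFun_congr
      (neg_mem (biPolyFun_swap (pencil_mem_biPolyFun_of_le (η := η) (a := a) (b := b) hα k l i j h)))
      fun u v _ => pencil_skew _ i j k l

/-- The relations of the pencil define a bracket. -/
theorem exists_satisfiesPencil (n : ℕ) (η β γ δ a b : ℂ) (hα : α ≠ 0) :
    ∃ br : CoeffBracket n, IsSkewBiderivation br ∧
      SatisfiesPencil η α β γ δ a b (fun i j u => polyMatrix n !![α, β; γ, δ] u i j) br := by
  choose M hM using fun i j k l =>
    pencil_mem_biPolyFun (n := n) (η := η) (β := β) (γ := γ) (δ := δ) (a := a) (b := b) hα i j k l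
  -- The chosen coefficients `M` are not known to be skew; antisymmetrizing preserves the relations
  -- because `pencil` itself is skew.
  let P (p q : Fin 2 × Fin 2 × Fin n) : CoeffAlgebra n :=
    (2⁻¹ : ℂ) • (M p.1 p.2.1 q.1 q.2.1 p.2.2 q.2.2 - M q.1 q.2.1 p.1 p.2.1 q.2.2 p.2.2)
  have hP : IsSkewBiderivation (bracketOf P) :=
    isSkewBiderivation_bracketOf fun p q => by rw [← smul_neg, neg_sub]
  refine ⟨bracketOf P, hP, fun i j k l u v huv => ?_⟩
  have h₁ := hM i j k l u v huv
  have h₂ := hM k l i j v u huv.symm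
  rw [Finset.sum_comm] at h₂
  rw [bracket_polyMatrix hP]
  simp only [bracketOf_X, P, smul_sub, Finset.sum_sub_distrib]
  simp only [smul_comm _ (2⁻¹ : ℂ), ← Finset.smul_sum]
  simp only [mul_comm (v ^ _)] at h₂
  rw [← h₁, ← h₂, pencil_skew _ k l i j]
  module

theorem SatisfiesPencil.unique {br br' : CoeffBracket n}
    {L : Matrix (Fin 2) (Fin 2) ℂ} (hbr : IsSkewBiderivation br) (hbr' : IsSkewBiderivation br')
    (h : SatisfiesPencil η α β γ δ a b (fun i j u => polyMatrix n L u i j) br)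
    (h' : SatisfiesPencil η α β γ δ a b (fun i j u => polyMatrix n L u i j) br') : br = br' :=
  hbr.ext_polyMatrix hbr' fun i j k l u v huv => (h i j k l u v huv).trans (h' i j k l u v huv).symm

theorem satisfiesSklyanin_iff (br : CoeffBracket n) :
    SatisfiesSklyanin n η !![α, β; γ, δ] br ↔
      SatisfiesPencil η α β γ δ 1 0 (fun i j u => polyMatrix n !![α, β; γ, δ] u i j) br := by
  have key (u v : ℂ) (i j k l : Fin 2) :
      ⁅(rationalRMatrix η (u - v)).map (MvPolynomial.C (σ := Fin 2 × Fin 2 × Fin n)),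
        (polyMatrix n !![α, β; γ, δ] u ⊗ₖ (1 : Matrix (Fin 2) (Fin 2) (CoeffAlgebra n))) *
          ((1 : Matrix (Fin 2) (Fin 2) (CoeffAlgebra n)) ⊗ₖ polyMatrix n !![α, β; γ, δ] v)⁆
            (i, k) (j, l) =
      pencil η α β γ δ 1 0 (fun i j u => polyMatrix n !![α, β; γ, δ] u i j) u v i j k l := by
    generalize polyMatrix n !![α, β; γ, δ] = T
    rw [← Matrix.mul_kronecker_mul, mul_one, one_mul]
    revert i j k l
    simp only [Fin.forall_fin_two]
    and_intros
    all_goals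
      simp [Ring.lie_def, Matrix.mul_apply, Fintype.sum_prod_type, Fin.sum_univ_two,
        rationalRMatrix, permMatrix, pencil, MvPolynomial.smul_eq_C_mul, neg_div]
      try ring
  constructor
  · intro h i j k l u v huv
    rw [← key]
    exact congrFun (congrFun (h u v huv) (i, k)) (j, l)
  · intro h u v huv
    ext1 ⟨i, k⟩ ⟨j, l⟩
    exact (h i j k l u v huv).trans (key u v i j k l).symm

theorem satisfiesSecond_iff {br : CoeffBracket n} (hbr : IsSkewBiderivation br) :
    SatisfiesSecond n η α β γ δ br ↔
      SatisfiesPencil η α β γ δ 0 1 (fun i j u => polyMatrix n !![α, β; γ, δ] u i j) br := by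
  constructor
  · intro h i j k l
    -- Only ten of the sixteen ordered pairs of entries are given; each pair may be checked in
    -- either order.
    suffices H : ∀ u v, u ≠ v →
        br (polyMatrix n !![α, β; γ, δ] u i j) (polyMatrix n !![α, β; γ, δ] v k l) =
          pencil η α β γ δ 0 1 (fun i j u => polyMatrix n !![α, β; γ, δ] u i j) u v i j k l ∨
        br (polyMatrix n !![α, β; γ, δ] v k l) (polyMatrix n !![α, β; γ, δ] u i j) =
          pencil η α β γ δ 0 1 (fun i j u => polyMatrix n !![α, β; γ, δ] u i j) v u k l i j by
      intro u v huv
      refine (H u v huv).elim id fun e => ?_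
      rw [pencil_skew, ← e, hbr.skew]
    revert i j k l
    simp only [Fin.forall_fin_two]
    and_intros
    all_goals intro u v huv
    all_goals simp only [pencil, zero_add, one_mul]
    · exact .inl (h.AA u v huv)
    · exact .inr (h.BA v u huv.symm)
    · exact .inr (h.CA v u huv.symm)
    · exact .inl (h.AD u v huv)
    · exact .inl (h.BA u v huv)
    · exact .inl (h.BB u v huv)
    · exact .inl (h.BC u v huv)
    · exact .inl (h.BD u v huv)
    · exact .inl (h.CA u v huv)
    · exact .inr (h.BC v u huv.symm)
    · exact .inl (h.CC u v huv)
    · exact .inl (h.CD u v huv)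
    · exact .inr (h.AD v u huv.symm)
    · exact .inr (h.BD v u huv.symm)
    · exact .inr (h.CD v u huv.symm)
    · exact .inl (h.DD u v huv)
  · intro h
    constructor <;> intro u v huv <;> rw [h _ _ _ _ u v huv] <;> simp [pencil]

end Pencil

theorem proposition1 (n : ℕ) (η α β γ δ : ℂ) (hα : α ≠ 0) :
    (∃! br₀ : CoeffBracket n,
      IsSkewBiderivation br₀ ∧ SatisfiesSklyanin n η !![α, β; γ, δ] br₀) ∧
    (∃! br₁ : CoeffBracket n,
      IsSkewBiderivation br₁ ∧ SatisfiesSecond n η α β γ δ br₁) ∧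
    ∀ br₀ br₁ : CoeffBracket n,
      IsSkewBiderivation br₀ → SatisfiesSklyanin n η !![α, β; γ, δ] br₀ →
      IsSkewBiderivation br₁ → SatisfiesSecond n η α β γ δ br₁ →
      AreCompatible br₀ br₁ := by
  refine ⟨?_, ?_, fun br₀ br₁ h₀ hs₀ h₁ hs₁ a b => ?_⟩
  · obtain ⟨br, hbr, h⟩ := exists_satisfiesPencil n η β γ δ 1 0 hα
    exact ⟨br, ⟨hbr, (satisfiesSklyanin_iff br).2 h⟩, fun br' ⟨hbr', h'⟩ =>
      SatisfiesPencil.unique hbr' hbr ((satisfiesSklyanin_iff br').1 h') h⟩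
  · obtain ⟨br, hbr, h⟩ := exists_satisfiesPencil n η β γ δ 0 1 hα
    exact ⟨br, ⟨hbr, (satisfiesSecond_iff hbr).2 h⟩, fun br' ⟨hbr', h'⟩ =>
      SatisfiesPencil.unique hbr' hbr ((satisfiesSecond_iff hbr').1 h') h⟩
  · refine SatisfiesPencil.isPoissonBracket (L := !![α, β; γ, δ]) (η := η) (β := β) (γ := γ)
      (δ := δ) (a := a) (b := b) hα ((h₀.smul a).add (h₁.smul b)) fun i j k l u v huv => ?_
    simp only [LinearMap.add_apply, LinearMap.smul_apply,
      (satisfiesSklyanin_iff br₀).1 hs₀ _ _ _ _ u v huv,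
      (satisfiesSecond_iff h₁).1 hs₁ _ _ _ _ u v huv]
    exact (pencil_linear _ i j k l).symm
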